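/- A set $I$ is called measurable if it is uncountable and there is a countably additive $\{0,1\}$-valued measure $\mu$ defined on all subsets of $I$ with $\mu(I)=1$ and $\mu(\{x\})=0$ for every $x\in I$; otherwise $I$ is non-measurable. A module homomorphism is a pure epimorphism if it is surjective and every homomorphism from a finitely presented module to its target lifts along it. An injective homomorphism $A\to B$ is a pure monomorphism if its cokernel map is a pure epimorphism. A module is pure injective if it is injective with respect to all pure monomorphisms, and a module $V$ is $\Sigma$-pure injective if the direct sum $V^{(K)}$ is pure injective for every set $K$. Let $R$ be a unital ring, and let $(U_i)_{i\in I}$ and $(V_j)_{j\in J}$ be two families of $R$-modules (all modules on the same fixed side) such that $J$ is infinite, $|J|>|U_i|$ for all $i\in I$, and all modules $V_j$ are isomorphic to a fixed module $V$. Suppose that $I$ is non-measurable and that there exists a pure epimorphism $$f:\prod_{i\in I} U_i\to \bigoplus_{j\in J}V_j.$$ Then $V$ is $\Sigma$-pure injective. -/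

import Mathlib

open scoped DirectSum

universe u v v₁ v₂ w w₁ w₂

/-- A set (type) `I` is *measurable* if it is uncountable and there is a countably additive
`{0,1}`-valued measure on its full power set (the σ-algebra `⊤`) which has total mass `1` and
vanishes on all points. -/
def IsMeasurableIndex (I : Type w) : Prop :=
  Uncountable I ∧ ∃ μ : @MeasureTheory.Measure I ⊤,
    (∀ s : Set I, μ s = 0 ∨ μ s = 1) ∧ μ Set.univ = 1 ∧ ∀ x : I, μ {x} = 0

section Purity

variable (R : Type u) [Ring R]

/-- A homomorphism is a *pure epimorphism* if it is surjective and every finitely presented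
module is projective with respect to it. Every finitely presented module is isomorphic to a
quotient of some `Fin n → R`, so it is enough to test with modules in the universe of `R`. -/
def IsPureEpi {M : Type v₁} {N : Type v₂} [AddCommGroup M] [Module R M] [AddCommGroup N]
    [Module R N] (f : M →ₗ[R] N) : Prop :=
  Function.Surjective f ∧
    ∀ (P : Type u) [AddCommGroup P] [Module R P] [Module.FinitePresentation R P]
      (g : P →ₗ[R] N), ∃ h : P →ₗ[R] M, f ∘ₗ h = g

/-- A homomorphism `i : A → B` is a *pure monomorphism* if it is injective and the projection
onto its cokernel is a pure epimorphism, that is, `0 → A → B → B / i(A) → 0` is pure exact. -/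
def IsPureMono {A : Type v₁} {B : Type v₂} [AddCommGroup A] [Module R A] [AddCommGroup B]
    [Module R B] (i : A →ₗ[R] B) : Prop :=
  Function.Injective i ∧ IsPureEpi R (LinearMap.range i).mkQ

/-- A module `M` is *pure injective* if it is injective with respect to all pure monomorphisms.
The pure injective hull of `M` has a copy in `Type (max u v)`, so testing with modules in that
universe (or any larger one) gives the usual notion. -/
def IsPureInjective (M : Type v) [AddCommGroup M] [Module R M] : Prop :=
  ∀ (A B : Type (max u v)) [AddCommGroup A] [Module R A] [AddCommGroup B] [Module R B]
    (i : A →ₗ[R] B), IsPureMono R i →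
      ∀ g : A →ₗ[R] M, ∃ h : B →ₗ[R] M, h ∘ₗ i = g

/-- A module `M` is *Σ-pure injective* if the direct sum `M^(K)` of copies of `M` is pure
injective, for every set `K`. -/
def IsSigmaPureInjective (M : Type v) [AddCommGroup M] [Module R M] : Prop :=
  ∀ K : Type w, IsPureInjective R (⨁ _ : K, M)

end Purity

/-!
# Pure epimorphisms from products onto direct sums and `Σ`-pure injectivity

The descending chain condition on pp-definable subgroups mediates between hypothesis and
conclusion.

*It implies the conclusion.* The condition passes from `V` to `V^(K)`, because pp-definable subgroups
of a direct sum are computed componentwise. A module satisfying it is algebraically compact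
(`FinitelySolvable.exists_solution`): by Zorn's lemma the variables of a finitely solvable system
are given values one at a time, where the chain condition makes the intersection of the cosets of
admissible values nonempty. Extending a homomorphism along a pure monomorphism is solving such a
system (`isPureInjective_of_ppDescendingChain`).

*It follows from the hypotheses.* For a chain of pp-definable subgroups, a form of Chase's lemma
(`exists_finite_isChaseSmall_compl`) bounds the map `f : ∏ U i → ⨁ V j`: from some step `n` on,
families in the `n`-th subgroup vanishing on a finite set `F` of indices are sent into the
intersection of the chain, up to finitely many coordinates `j`. The proof shows that the sets of
indices with this property form an ideal which meets every sequence of sets decreasing to `∅`.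
Its quotient Boolean algebra has atoms below every nonzero element, an atom induces a
`{0,1}`-valued measure, and on a non-measurable index set this measure is concentrated at a point;
since only finitely many points lie outside the ideal, a cofinite set belongs to it. As pure
epimorphisms are surjective on pp-definable subgroups, a chain in `V` which is not stationary
would embed, modulo its intersection, more than `|∏ i ∈ F, U i|` different elements into the
image of the finite product, which contradicts the bound on the cardinalities
(`ppDescendingChain_of_isPureEpi`).

A pp-definable subgroup is encoded by a set of linear forms in an arbitrary type of variables,
so no renaming of variables is needed except for lifting solutions along pure epimorphisms
(`IsPureEpi.exists_lift_solution`), which are tested on finitely presented modules only.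
-/

/-! ### Ideals of sets on a non-measurable index set -/

section SetIdeal

variable {I : Type w} {𝓘 : Set (Set I)}

theorem biUnion_lt_mem_of_union_mem (hempty : ∅ ∈ 𝓘)
    (hunion : ∀ S ∈ 𝓘, ∀ T ∈ 𝓘, S ∪ T ∈ 𝓘) (A : ℕ → Set I) (hA : ∀ n, A n ∈ 𝓘) (m : ℕ) :
    (⋃ k < m, A k) ∈ 𝓘 := by
  induction m with
  | zero => simpa using hempty
  | succ m ih =>
    rw [Set.biUnion_lt_succ]
    exact hunion _ ih _ (hA m)

/-- An ideal of sets containing a member of every sequence decreasing to `∅` is a `σ`-ideal. -/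
theorem iUnion_mem_of_chain (hmono : ∀ S T : Set I, S ⊆ T → T ∈ 𝓘 → S ∈ 𝓘)
    (hunion : ∀ S ∈ 𝓘, ∀ T ∈ 𝓘, S ∪ T ∈ 𝓘)
    (hchain : ∀ T : ℕ → Set I, Antitone T → ⋂ n, T n = ∅ → ∃ n, T n ∈ 𝓘)
    (A : ℕ → Set I) (hA : ∀ n, A n ∈ 𝓘) : (⋃ n, A n) ∈ 𝓘 := by
  obtain ⟨m, hm⟩ := hchain (fun m => (⋃ n, A n) \ ⋃ k < m, A k)
    (fun m n hmn => Set.sdiff_subset_sdiff_right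
      (Set.biUnion_subset_biUnion_left fun k (hk : k < m) => lt_of_lt_of_le hk hmn))
    (by
      refine Set.eq_empty_of_forall_notMem fun x hx => ?_
      obtain ⟨k, hk⟩ := Set.mem_iUnion.1 (Set.mem_iInter.1 hx 0).1
      exact (Set.mem_iInter.1 hx (k + 1)).2 (Set.mem_biUnion (Nat.lt_succ_self k) hk))
  have hfin := biUnion_lt_mem_of_union_mem (hmono ∅ _ (Set.empty_subset _) (hA 0)) hunion A hA m
  refine hmono _ _ (fun x hx => ?_) (hunion _ hm _ hfin)
  by_cases h : x ∈ ⋃ k < m, A k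
  · exact Or.inr h
  · exact Or.inl ⟨hx, h⟩

theorem exists_mem_of_pairwise_disjoint (hmono : ∀ S T : Set I, S ⊆ T → T ∈ 𝓘 → S ∈ 𝓘)
    (hchain : ∀ T : ℕ → Set I, Antitone T → ⋂ n, T n = ∅ → ∃ n, T n ∈ 𝓘)
    (A : ℕ → Set I) (hA : ∀ m n, m < n → Disjoint (A m) (A n)) : ∃ n, A n ∈ 𝓘 := by
  obtain ⟨m, hm⟩ := hchain (fun m => ⋃ k ≥ m, A k)
    (fun m n hmn => Set.biUnion_subset_biUnion_left fun k (hk : n ≤ k) => hmn.trans hk)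
    (by
      refine Set.eq_empty_of_forall_notMem fun x hx => ?_
      obtain ⟨k, -, hk⟩ := Set.mem_iUnion₂.1 (Set.mem_iInter.1 hx 0)
      obtain ⟨l, hl, hl'⟩ := Set.mem_iUnion₂.1 (Set.mem_iInter.1 hx (k + 1))
      exact Set.disjoint_left.1 (hA k l hl) hk hl')
  exact ⟨m, hmono _ _ (Set.subset_biUnion_of_mem (u := A) (show m ≥ m from le_rfl)) hm⟩

/-- Every set outside the ideal contains an atom of the quotient Boolean algebra: otherwise it
could be split again and again into an infinite sequence of disjoint sets outside the ideal. -/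
theorem exists_atom_subset (hmono : ∀ S T : Set I, S ⊆ T → T ∈ 𝓘 → S ∈ 𝓘)
    (hchain : ∀ T : ℕ → Set I, Antitone T → ⋂ n, T n = ∅ → ∃ n, T n ∈ 𝓘)
    {S : Set I} (hS : S ∉ 𝓘) :
    ∃ T ⊆ S, T ∉ 𝓘 ∧ ∀ A ⊆ T, A ∈ 𝓘 ∨ T \ A ∈ 𝓘 := by
  by_contra! hno
  have hsplit : ∀ T : {T : Set I // T ⊆ S ∧ T ∉ 𝓘}, ∃ A ⊆ T.1, A ∉ 𝓘 ∧ T.1 \ A ∉ 𝓘 :=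
    fun T => hno T.1 T.2.1 T.2.2
  choose A hAT hA hTA using hsplit
  let T : ℕ → {T : Set I // T ⊆ S ∧ T ∉ 𝓘} := fun n => Nat.rec ⟨S, subset_rfl, hS⟩
    (fun _ T => ⟨T.1 \ A T, Set.sdiff_subset.trans T.2.1, hTA T⟩) n
  have hsucc : ∀ n, (T (n + 1)).1 = (T n).1 \ A (T n) := fun n => rfl
  have hanti : Antitone fun n => (T n).1 :=
    antitone_nat_of_succ_le fun n => by rw [hsucc]; exact Set.sdiff_subset
  obtain ⟨n, hn⟩ := exists_mem_of_pairwise_disjoint hmono hchain (fun n => A (T n)) (by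
    intro m n hmn
    refine Set.disjoint_left.2 fun x hxm hxn => ?_
    have hx : x ∈ (T (m + 1)).1 := hanti (Nat.succ_le_of_lt hmn) (hAT _ hxn)
    rw [hsucc] at hx
    exact hx.2 hxm)
  exact hA _ hn

/-- On a non-measurable set, an atom of a `σ`-ideal contains a point outside the ideal: if it did
not, the complement of the ideal would define a `{0,1}`-valued measure vanishing on points. -/
theorem exists_singleton_notMem_of_atom (hI : ¬ IsMeasurableIndex I)
    (hmono : ∀ S T : Set I, S ⊆ T → T ∈ 𝓘 → S ∈ 𝓘)
    (hUnion : ∀ A : ℕ → Set I, (∀ n, A n ∈ 𝓘) → (⋃ n, A n) ∈ 𝓘)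
    {T : Set I} (hT : T ∉ 𝓘) (hatom : ∀ A ⊆ T, A ∈ 𝓘 ∨ T \ A ∈ 𝓘) (hne : ∅ ∈ 𝓘) :
    ∃ x ∈ T, {x} ∉ 𝓘 := by
  classical
  by_contra! hpt
  have hunion : ∀ S ∈ 𝓘, ∀ S' ∈ 𝓘, S ∪ S' ∈ 𝓘 := by
    intro S hS S' hS'
    refine hmono _ _ ?_ (hUnion (fun n => if n = 0 then S else S')
      (fun n => by split_ifs <;> assumption))
    refine Set.union_subset (fun x hx => Set.mem_iUnion.2 ⟨0, by simpa using hx⟩)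
      (fun x hx => Set.mem_iUnion.2 ⟨1, by simpa using hx⟩)
  let m : MeasureTheory.OuterMeasure I :=
    { measureOf := fun s => if T ∩ s ∈ 𝓘 then 0 else 1
      empty := by simp [hne]
      mono := by
        intro s t hst
        split_ifs with h₁ h₂ h₂
        · exact le_rfl
        · exact zero_le_one
        · exact absurd (hmono _ _ (Set.inter_subset_inter_right _ hst) h₂) h₁
        · exact le_rfl
      iUnion_nat := by
        intro s _
        by_cases h : ∀ n, T ∩ s n ∈ 𝓘
        · rw [if_pos (by rw [Set.inter_iUnion]; exact hUnion _ h)]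
          exact zero_le
        · push Not at h
          obtain ⟨n, hn⟩ := h
          calc _ ≤ (1 : ENNReal) := by split_ifs <;> simp
            _ = if T ∩ s n ∈ 𝓘 then 0 else 1 := by rw [if_neg hn]
            _ ≤ _ := ENNReal.le_tsum n }
  have hm : ∀ s, m s = if T ∩ s ∈ 𝓘 then 0 else 1 := fun s => rfl
  have hcar : (⊤ : MeasurableSpace I) ≤ m.caratheodory := by
    intro s _
    refine (MeasureTheory.OuterMeasure.isCaratheodory_iff_le' m).2 fun t => ?_
    simp only [hm]
    have hsplit : T ∩ t ⊆ T ∩ (t ∩ s) ∪ T ∩ (t \ s) := by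
      rw [← Set.inter_union_distrib_left, Set.inter_union_sdiff]
    have htot : T ∩ (t ∩ s) ∈ 𝓘 → T ∩ (t \ s) ∈ 𝓘 → T ∩ t ∈ 𝓘 := fun h h' =>
      hmono _ _ hsplit (hunion _ h _ h')
    have hle₁ : T ∩ t ∈ 𝓘 → T ∩ (t ∩ s) ∈ 𝓘 :=
      hmono _ _ (Set.inter_subset_inter_right _ Set.inter_subset_left)
    have hle₂ : T ∩ t ∈ 𝓘 → T ∩ (t \ s) ∈ 𝓘 :=
      hmono _ _ (Set.inter_subset_inter_right _ Set.sdiff_subset)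
    -- As `T` is an atom, one of the two pieces is null.
    have hone : T ∩ (t ∩ s) ∈ 𝓘 ∨ T ∩ (t \ s) ∈ 𝓘 := by
      rcases hatom (T ∩ s) Set.inter_subset_left with h | h
      · exact Or.inl (hmono _ _ (Set.inter_subset_inter_right _ Set.inter_subset_right) h)
      · exact Or.inr (hmono _ (T \ (T ∩ s)) (fun z hz => ⟨hz.1, fun hz' => hz.2.2 hz'.2⟩) h)
    split_ifs <;> first | simp; done | (exfalso; tauto)
  have hpoint : ∀ x, T ∩ {x} ∈ 𝓘 := fun x => by
    by_cases hx : x ∈ T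
    · exact hmono _ _ Set.inter_subset_right (hpt x hx)
    · refine hmono _ _ (fun y hy => ?_) hne
      exact hx ((Set.mem_singleton_iff.1 hy.2) ▸ hy.1)
  refine hI ⟨?_, ?_⟩
  · rw [← not_countable_iff]
    intro hcount
    rcases isEmpty_or_nonempty I with hemp | hnonempty
    · exact hT (by rwa [Set.eq_empty_of_isEmpty T])
    · obtain ⟨e, he⟩ := exists_surjective_nat I
      refine hT (hmono _ _ (fun x hx => ?_) (hUnion (fun n => T ∩ {e n}) fun n => hpoint _))
      obtain ⟨n, rfl⟩ := he x
      exact Set.mem_iUnion.2 ⟨n, hx, rfl⟩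
  · let _ : MeasurableSpace I := ⊤
    have happ : ∀ s, m.toMeasure hcar s = if T ∩ s ∈ 𝓘 then 0 else 1 := fun s =>
      (MeasureTheory.toMeasure_apply m hcar trivial).trans (hm s)
    refine ⟨m.toMeasure hcar, fun s => ?_, ?_, fun x => ?_⟩
    · rw [happ]
      split_ifs <;> simp
    · rw [happ, Set.inter_univ, if_neg hT]
    · rw [happ, if_pos (hpoint x)]

/-- On a non-measurable set, an ideal which contains a member of every sequence decreasing to
`∅` contains a cofinite set. -/
theorem exists_finite_compl_mem (hI : ¬ IsMeasurableIndex I)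
    (hmono : ∀ S T : Set I, S ⊆ T → T ∈ 𝓘 → S ∈ 𝓘)
    (hunion : ∀ S ∈ 𝓘, ∀ T ∈ 𝓘, S ∪ T ∈ 𝓘)
    (hchain : ∀ T : ℕ → Set I, Antitone T → ⋂ n, T n = ∅ → ∃ n, T n ∈ 𝓘) :
    ∃ F : Set I, F.Finite ∧ Fᶜ ∈ 𝓘 := by
  have hne : ∅ ∈ 𝓘 := by
    obtain ⟨_, h⟩ := hchain (fun _ => ∅) antitone_const (Set.iInter_const _)
    exact h
  have hfin : {x : I | {x} ∉ 𝓘}.Finite := by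
    by_contra hinf
    let e := Set.Infinite.natEmbedding _ hinf
    obtain ⟨n, hn⟩ := exists_mem_of_pairwise_disjoint hmono hchain (fun n => {(e n : I)})
      (fun m n hmn => Set.disjoint_singleton.2 fun h =>
        hmn.ne (e.injective (Subtype.ext h)))
    exact (e n).2 hn
  refine ⟨_, hfin, ?_⟩
  by_contra hpos
  obtain ⟨T, hTS, hT, hatom⟩ := exists_atom_subset hmono hchain hpos
  obtain ⟨x, hxT, hx⟩ := exists_singleton_notMem_of_atom hI hmono
    (iUnion_mem_of_chain hmono hunion hchain) hT hatom hne
  exact hTS hxT hx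

end SetIdeal

/-! ### Chase's lemma for filtered abelian groups -/

section Chase

variable {I : Type w₁} {J : Type w₂} {U : I → Type v₁} {V : J → Type v₂}
  [∀ i, AddCommGroup (U i)] [∀ j, AddCommGroup (V j)]

/-- A set `S` of indices is *small* for a homomorphism `f : ∏ U i → ⨁ V j` between groups with
filtrations `A` and `C` if for some `n` the map `f` sends every family in the `n`-th step of the
filtration and supported in `S` into `⋂ k, C k`, up to finitely many coordinates which do not
depend on the family. -/
def IsChaseSmall (f : (∀ i, U i) →+ (⨁ j, V j)) (A : ℕ → ∀ i, AddSubgroup (U i))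
    (C : ℕ → ∀ j, AddSubgroup (V j)) (S : Set I) : Prop :=
  ∃ (n : ℕ) (J' : Finset J), ∀ u : ∀ i, U i, (∀ i, u i ∈ A n i) → (∀ i ∉ S, u i = 0) →
    ∀ j ∉ J', ∀ k, f u j ∈ C k j

variable {f : (∀ i, U i) →+ (⨁ j, V j)} {A : ℕ → ∀ i, AddSubgroup (U i)}
  {C : ℕ → ∀ j, AddSubgroup (V j)}

theorem IsChaseSmall.mono {S T : Set I} (hST : S ⊆ T) (hT : IsChaseSmall f A C T) :
    IsChaseSmall f A C S := by
  obtain ⟨n, J', h⟩ := hT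
  exact ⟨n, J', fun u hu hS => h u hu fun i hi => hS i fun hi' => hi (hST hi')⟩

theorem IsChaseSmall.union (hA : ∀ i, Antitone fun n => A n i) {S T : Set I}
    (hS : IsChaseSmall f A C S) (hT : IsChaseSmall f A C T) : IsChaseSmall f A C (S ∪ T) := by
  classical
  obtain ⟨n, J₁, h₁⟩ := hS
  obtain ⟨m, J₂, h₂⟩ := hT
  refine ⟨max n m, J₁ ∪ J₂, fun u hu hST j hj k => ?_⟩
  rw [Finset.mem_union, not_or] at hj
  let a : ∀ i, U i := fun i => if i ∈ S then u i else 0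
  let b : ∀ i, U i := fun i => if i ∈ S then 0 else u i
  have hab : u = a + b := by
    ext i
    by_cases hi : i ∈ S <;> simp [a, b, hi]
  rw [hab, map_add, DirectSum.add_apply]
  refine add_mem (h₁ a (fun i => ?_) (fun i hi => if_neg hi) j hj.1 k)
    (h₂ b (fun i => ?_) (fun i hi => ?_) j hj.2 k)
  · by_cases hi : i ∈ S
    · simpa [a, hi] using hA i (le_max_left n m) (hu i)
    · simp [a, hi]
  · by_cases hi : i ∈ S
    · simp [b, hi]
    · simpa [b, hi] using hA i (le_max_right n m) (hu i)
  · by_cases hi' : i ∈ S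
    · simp [b, hi']
    · simpa [b, hi'] using hST i (by simp [hi, hi'])

/-- **Chase's lemma.** If `T m` decreases to `∅`, then some `T m` is small. Otherwise one chooses
families `w m` supported in `T m`, ever deeper in the filtration, and new coordinates `j m` at
which `f (w m)` is not as deep as the families chosen afterwards. The sum of all `w m` exists in
the product because each index leaves the sets `T m`, and its image has every `j m` in its
support. -/
theorem exists_isChaseSmall_of_antitone (hA : ∀ i, Antitone fun n => A n i)
    (hC : ∀ j, Antitone fun n => C n j)
    (hf : ∀ n (u : ∀ i, U i), (∀ i, u i ∈ A n i) → ∀ j, f u j ∈ C n j)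
    (T : ℕ → Set I) (hT : Antitone T) (hempty : ⋂ n, T n = ∅) :
    ∃ m, IsChaseSmall f A C (T m) := by
  classical
  by_contra! hbad
  simp only [IsChaseSmall] at hbad
  push Not at hbad
  choose u huA huT j hjJ k hk using hbad
  let st : ℕ → ℕ × Finset J := fun m => Nat.rec (0, ∅)
    (fun m p => (max p.1 (k m p.1 p.2), p.2 ∪ DFinsupp.support (f (u m p.1 p.2)))) m
  let d : ℕ → ℕ := fun m => (st m).1
  let w : ℕ → ∀ i, U i := fun m => u m (st m).1 (st m).2
  let q : ℕ → J := fun m => j m (st m).1 (st m).2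
  have hst : ∀ m, st (m + 1) = (max (d m) (k m (st m).1 (st m).2),
    (st m).2 ∪ DFinsupp.support (f (w m))) := fun m => rfl
  have hd : Monotone d := monotone_nat_of_le_succ fun m => by
    show d m ≤ (st (m + 1)).1
    rw [hst]; exact le_max_left _ _
  have hJ : Monotone fun m => (st m).2 := monotone_nat_of_le_succ fun m => by
    show (st m).2 ≤ (st (m + 1)).2
    rw [hst]; exact Finset.subset_union_left
  have hwA : ∀ m i, w m i ∈ A (d m) i := fun m => huA m _ _
  have hwT : ∀ m, ∀ i ∉ T m, w m i = 0 := fun m => huT m _ _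
  have hq : ∀ m, q m ∉ (st m).2 := fun m => hjJ m _ _
  have hwC : ∀ m, f (w m) (q m) ∉ C (d (m + 1)) (q m) := fun m h =>
    hk m _ _ (hC (q m) (show k m (st m).1 (st m).2 ≤ (st (m + 1)).1 by
      rw [hst]; exact le_max_right _ _) h)
  have hsupp : ∀ m l, m < l → ∀ j ∉ (st l).2, f (w m) j = 0 := by
    intro m l hml j hj
    by_contra h
    refine hj (hJ (Nat.succ_le_of_lt hml) ?_)
    show j ∈ (st (m + 1)).2
    rw [hst]
    exact Finset.mem_union_right _ (DFinsupp.mem_support_iff.2 h)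
  have hleave : ∀ i, ∃ N, ∀ m, N ≤ m → w m i = 0 := by
    intro i
    have hi : i ∉ ⋂ n, T n := by rw [hempty]; exact Set.notMem_empty i
    obtain ⟨N, hN⟩ := not_forall.1 (mt Set.mem_iInter.2 hi)
    exact ⟨N, fun m hm => hwT m i fun h => hN (hT hm h)⟩
  choose N hN using hleave
  let total : ∀ i, U i := fun i => ∑ m ∈ Finset.range (N i), w m i
  have htail : ∀ l i, (total - ∑ m ∈ Finset.range l, w m) i ∈ A (d l) i := by
    intro l i
    have h₁ : total i = ∑ m ∈ Finset.range (max (N i) l), w m i := by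
      refine Finset.sum_subset (Finset.range_mono (le_max_left _ _)) fun m _ hm => ?_
      exact hN i m (by simpa using hm)
    rw [Pi.sub_apply, Finset.sum_apply, h₁, ← Finset.sum_Ico_eq_sub _ (le_max_right _ _)]
    exact sum_mem fun m hm => hA i (hd (Finset.mem_Ico.1 hm).1) (hwA m i)
  have hmem : ∀ m, q m ∈ DFinsupp.support (f total) := by
    intro m
    refine DFinsupp.mem_support_iff.2 fun h0 => hwC m ?_
    have h₁ := hf _ _ (htail (m + 1)) (q m)
    have h₂ : ∑ l ∈ Finset.range m, f (w l) (q m) = 0 :=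
      Finset.sum_eq_zero fun l hl => hsupp l m (Finset.mem_range.1 hl) _ (hq m)
    rw [map_sub, map_sum, DirectSum.sub_apply, DFinsupp.finsetSum_apply,
      Finset.sum_range_succ, h₂, zero_add, h0, zero_sub] at h₁
    exact neg_mem_iff.1 h₁
  have hinj : Function.Injective q := by
    have hlt : ∀ m l, m < l → q m ≠ q l := by
      intro m l hml h
      have h0 := hsupp m l hml (q l) (hq l)
      rw [← h] at h0
      exact hwC m (h0 ▸ zero_mem _)
    intro m l h
    rcases lt_trichotomy m l with h' | h' | h'
    · exact absurd h (hlt _ _ h')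
    · exact h'
    · exact absurd h.symm (hlt _ _ h')
  exact Set.infinite_of_injective_forall_mem hinj hmem (Finset.finite_toSet _)

/-- Chase's lemma for products over a non-measurable index set: a cofinite set of indices is
small. -/
theorem exists_finite_isChaseSmall_compl (hI : ¬ IsMeasurableIndex I)
    (hA : ∀ i, Antitone fun n => A n i) (hC : ∀ j, Antitone fun n => C n j)
    (hf : ∀ n (u : ∀ i, U i), (∀ i, u i ∈ A n i) → ∀ j, f u j ∈ C n j) :
    ∃ F : Set I, F.Finite ∧ IsChaseSmall f A C Fᶜ :=
  exists_finite_compl_mem (𝓘 := {S | IsChaseSmall f A C S}) hI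
    (fun _ _ hST hT => hT.mono hST) (fun _ hS _ hT => hS.union hA hT)
    (exists_isChaseSmall_of_antitone hA hC hf)

end Chase

/-! ### Subgroups defined by linear systems -/

section PPSubgroup

variable {R : Type u} [Ring R] {X : Type w}

theorem linearCombination_add_left {M : Type v} [AddCommGroup M] [Module R M] (s t : X → M)
    (e : X →₀ R) : Finsupp.linearCombination R (s + t) e =
      Finsupp.linearCombination R s e + Finsupp.linearCombination R t e := by
  simp [Finsupp.linearCombination_apply]

theorem linearCombination_sub_left {M : Type v} [AddCommGroup M] [Module R M] (s t : X → M)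
    (e : X →₀ R) : Finsupp.linearCombination R (s - t) e =
      Finsupp.linearCombination R s e - Finsupp.linearCombination R t e := by
  simp [Finsupp.linearCombination_apply, smul_sub]

/-- The subgroup of `M` defined by the positive primitive formula which asserts of the variable
`x` that the homogeneous linear system `E` in the variables `X` has a solution with the given
value at `x`. Elements of `X →₀ R` encode linear forms; all variables other than `x` are
existentially quantified. It is pp-definable in the usual sense only for finite `E`. -/
def ppSubgroup (E : Set (X →₀ R)) (x : X) (M : Type v) [AddCommGroup M] [Module R M] :
    AddSubgroup M where
  carrier := {m | ∃ s : X → M, (∀ e ∈ E, Finsupp.linearCombination R s e = 0) ∧ s x = m}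
  zero_mem' := ⟨0, fun e _ => by simp, rfl⟩
  add_mem' := by
    rintro _ _ ⟨s, hs, rfl⟩ ⟨t, ht, rfl⟩
    refine ⟨s + t, fun e he => ?_, rfl⟩
    rw [linearCombination_add_left, hs e he, ht e he, add_zero]
  neg_mem' := by
    rintro _ ⟨s, hs, rfl⟩
    refine ⟨-s, fun e he => ?_, rfl⟩
    rw [← zero_sub, linearCombination_sub_left, hs e he, sub_zero,
      Finsupp.linearCombination_zero, LinearMap.zero_apply]

variable {E E' : Set (X →₀ R)} {x : X} {M : Type v₁} {N : Type v₂} [AddCommGroup M] [Module R M]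
  [AddCommGroup N] [Module R N]

theorem ppSubgroup_anti (h : E ⊆ E') : ppSubgroup E' x M ≤ ppSubgroup E x M := by
  rintro _ ⟨s, hs, rfl⟩
  exact ⟨s, fun e he => hs e (h he), rfl⟩

theorem map_mem_ppSubgroup (g : M →ₗ[R] N) {m : M} (hm : m ∈ ppSubgroup E x M) :
    g m ∈ ppSubgroup E x N := by
  obtain ⟨s, hs, rfl⟩ := hm
  refine ⟨g ∘ s, fun e he => ?_, rfl⟩
  rw [← Finsupp.apply_linearCombination, hs e he, map_zero]

theorem mem_ppSubgroup_pi {I : Type w₁} {U : I → Type v₁} [∀ i, AddCommGroup (U i)]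
    [∀ i, Module R (U i)] {a : ∀ i, U i} (ha : ∀ i, a i ∈ ppSubgroup E x (U i)) :
    a ∈ ppSubgroup E x (∀ i, U i) := by
  choose s hs hsx using ha
  refine ⟨fun y i => s i y, fun e he => funext fun i => ?_, funext hsx⟩
  exact (Finsupp.apply_linearCombination R (LinearMap.proj (R := R) (φ := U) i) _ e).trans
    (hs i e he)

theorem mem_ppSubgroup_directSum {J : Type w₁} {V : J → Type v₁} [∀ j, AddCommGroup (V j)]
    [∀ j, Module R (V j)] {a : ⨁ j, V j} (ha : ∀ j, a j ∈ ppSubgroup E x (V j)) :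
    a ∈ ppSubgroup E x (⨁ j, V j) := by
  classical
  rw [← DirectSum.sum_support_of a]
  exact sum_mem fun j _ => map_mem_ppSubgroup (DirectSum.lof R J V j) (ha j)

/-- Solutions of finite linear systems lift along pure epimorphisms. -/
theorem IsPureEpi.exists_lift_solution {g : M →ₗ[R] N} (hg : IsPureEpi R g) (hE : E.Finite)
    (t : X → N) (ht : ∀ e ∈ E, Finsupp.linearCombination R t e = 0) :
    ∃ s : X → M, (∀ e ∈ E, Finsupp.linearCombination R s e = 0) ∧ ∀ y, g (s y) = t y := by
  classical
  -- The system involves only finitely many variables; numbering them by `Fin k` produces a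
  -- finitely presented module in the universe of `R`.
  let F : Finset X := hE.toFinset.biUnion Finsupp.support
  let b : Fin F.card → X := fun q => (F.equivFin.symm q : X)
  have hb : Function.Injective b := Subtype.val_injective.comp F.equivFin.symm.injective
  have hbF : ∀ y ∈ F, ∃ q, b q = y := fun y hy => ⟨F.equivFin ⟨y, hy⟩, by simp [b]⟩
  let E₀ : Set (Fin F.card →₀ R) := Finsupp.mapDomain b ⁻¹' E
  have hE₀ : E₀.Finite := hE.preimage (Finsupp.mapDomain_injective hb).injOn
  have hE₀E : ∀ e ∈ E, ∃ c ∈ E₀, Finsupp.mapDomain b c = e := by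
    intro e he
    have h : Finsupp.mapDomain b (Finsupp.comapDomain b e hb.injOn) = e :=
      Finsupp.mapDomain_comapDomain b hb e fun y hy =>
        hbF y (Finset.mem_biUnion.2 ⟨e, hE.mem_toFinset.2 he, hy⟩)
    exact ⟨_, by rw [Set.mem_preimage, h]; exact he, h⟩
  let K : Submodule R (Fin F.card →₀ R) := Submodule.span R E₀
  have hfp : Module.FinitePresentation R ((Fin F.card →₀ R) ⧸ K) :=
    Module.finitePresentation_of_surjective K.mkQ K.mkQ_surjective
      (by rw [Submodule.ker_mkQ]; exact ⟨hE₀.toFinset, by simp [K]⟩)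
  have hK : K ≤ LinearMap.ker (Finsupp.linearCombination R (t ∘ b)) := by
    refine Submodule.span_le.2 fun c hc => ?_
    rw [SetLike.mem_coe, LinearMap.mem_ker, ← Finsupp.linearCombination_mapDomain]
    exact ht _ hc
  obtain ⟨h, hh⟩ := hg.2 _ (K.liftQ _ hK)
  choose r hr using fun y => hg.1 (t y)
  let a : Fin F.card → M := fun q => h (K.mkQ (Finsupp.single q 1))
  have ha : Finsupp.linearCombination R a = h ∘ₗ K.mkQ := by
    ext q
    simp [a]
  refine ⟨Function.extend b a r, fun e he => ?_, fun y => ?_⟩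
  · obtain ⟨c, hc, rfl⟩ := hE₀E e he
    rw [Finsupp.linearCombination_mapDomain, Function.extend_comp hb, ha, LinearMap.comp_apply,
      Submodule.mkQ_apply, (Submodule.Quotient.mk_eq_zero K).2 (Submodule.subset_span hc),
      map_zero]
  · by_cases hy : ∃ q, b q = y
    · obtain ⟨q, rfl⟩ := hy
      rw [hb.extend_apply]
      have := LinearMap.congr_fun hh (K.mkQ (Finsupp.single q 1))
      simpa [a] using this
    · rw [Function.extend_apply' _ _ _ hy]
      exact hr y

end PPSubgroup

/-! ### The descending chain condition implies pure injectivity -/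

section AlgebraicallyCompact

variable {R : Type u} [Ring R] {X : Type w} {M : Type v} [AddCommGroup M] [Module R M]

/-- The descending chain condition on pp-definable subgroups of `M`, for systems in a fixed set
`X` of variables. -/
def PPDescendingChain (R : Type u) [Ring R] (X : Type w) (M : Type v) [AddCommGroup M]
    [Module R M] : Prop :=
  ∀ (x : X) (E : ℕ → Set (X →₀ R)), Monotone E → (∀ n, (E n).Finite) →
    ∃ n, ∀ k, ppSubgroup (E n) x M ≤ ppSubgroup (E k) x M

/-- A system of inhomogeneous linear equations in the variables `X`, given as a set of pairs
(linear form, right-hand side), is *finitely solvable* if all its finite subsystems have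
solutions. -/
def FinitelySolvable (S : Set ((X →₀ R) × M)) : Prop :=
  ∀ T ⊆ S, T.Finite → ∃ s : X → M, ∀ p ∈ T, Finsupp.linearCombination R s p.1 = p.2

/-- One variable of a finitely solvable system can be given a value. The possible values of `x`
in the solutions of a finite subsystem form a coset of a pp-definable subgroup; for a subsystem
with minimal subgroup, every element of this coset extends to all finite subsystems. -/
theorem FinitelySolvable.exists_insert (hM : PPDescendingChain R X M)
    {S : Set ((X →₀ R) × M)} (hS : FinitelySolvable S) (x : X) :
    ∃ m : M, FinitelySolvable (insert (Finsupp.single x 1, m) S) := by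
  obtain ⟨T₀, hT₀S, hT₀, hmin⟩ : ∃ T₀ ⊆ S, T₀.Finite ∧ ∀ T ⊆ S, T.Finite →
      ppSubgroup (Prod.fst '' T₀) x M ≤ ppSubgroup (Prod.fst '' (T₀ ∪ T)) x M := by
    by_contra! hno
    have hno' : ∀ T₀ : {T : Set ((X →₀ R) × M) // T ⊆ S ∧ T.Finite}, ∃ T ⊆ S, T.Finite ∧
        ¬ ppSubgroup (Prod.fst '' T₀.1) x M ≤ ppSubgroup (Prod.fst '' (T₀.1 ∪ T)) x M :=
      fun T₀ => hno T₀.1 T₀.2.1 T₀.2.2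
    choose T hTS hT hlt using hno'
    let C : ℕ → {T : Set ((X →₀ R) × M) // T ⊆ S ∧ T.Finite} := fun n =>
      Nat.rec ⟨∅, Set.empty_subset _, Set.finite_empty⟩
        (fun _ D => ⟨D.1 ∪ T D, Set.union_subset D.2.1 (hTS D), D.2.2.union (hT D)⟩) n
    have hsucc : ∀ n, (C (n + 1)).1 = (C n).1 ∪ T (C n) := fun n => rfl
    obtain ⟨n, hn⟩ := hM x (fun n => Prod.fst '' (C n).1)
      (monotone_nat_of_le_succ fun n => by
        rw [hsucc]; exact Set.image_mono Set.subset_union_left)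
      (fun n => (C n).2.2.image _)
    exact hlt (C n) (hsucc n ▸ hn (n + 1))
  obtain ⟨s₀, hs₀⟩ := hS T₀ hT₀S hT₀
  refine ⟨s₀ x, fun T hTS hT => ?_⟩
  have hT'S : T ∩ S ⊆ S := Set.inter_subset_right
  have hT' : (T ∩ S).Finite := hT.inter_of_left _
  obtain ⟨s₁, hs₁⟩ := hS (T₀ ∪ T ∩ S) (Set.union_subset hT₀S hT'S) (hT₀.union hT')
  have hdiff : s₁ x - s₀ x ∈ ppSubgroup (Prod.fst '' T₀) x M := by
    refine ⟨s₁ - s₀, ?_, rfl⟩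
    rintro _ ⟨p, hp, rfl⟩
    rw [linearCombination_sub_left, hs₁ p (Or.inl hp), hs₀ p hp, sub_self]
  obtain ⟨s₂, hs₂, hs₂x⟩ := hmin _ hT'S hT' hdiff
  refine ⟨s₁ - s₂, fun p hp => ?_⟩
  rcases hTS hp with rfl | hpS
  · simp [hs₂x]
  · rw [linearCombination_sub_left, hs₁ p (Or.inr ⟨hp, hpS⟩),
      hs₂ _ ⟨p, Or.inr ⟨hp, hpS⟩, rfl⟩, sub_zero]

/-- A module with the descending chain condition on pp-definable subgroups is algebraically
compact: finitely solvable systems are solvable. -/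
theorem FinitelySolvable.exists_solution (hM : PPDescendingChain R X M)
    {S : Set ((X →₀ R) × M)} (hS : FinitelySolvable S) :
    ∃ s : X → M, ∀ p ∈ S, Finsupp.linearCombination R s p.1 = p.2 := by
  obtain ⟨S', hSS', hmax⟩ := zorn_subset_nonempty {S : Set ((X →₀ R) × M) | FinitelySolvable S}
    (fun c hc hchain hne => ⟨⋃₀ c, fun T hT hfin => by
        obtain ⟨D, hD, hTD⟩ := hchain.directedOn.exists_mem_subset_of_finite_of_subset_sUnion
          hne hfin hT
        exact hc hD T hTD hfin, fun _ => Set.subset_sUnion_of_mem⟩) S hS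
  have hval : ∀ x : X, ∃ m : M, (Finsupp.single x (1 : R), m) ∈ S' := by
    intro x
    obtain ⟨m, hm⟩ := hmax.1.exists_insert hM x
    exact ⟨m, hmax.2 hm (Set.subset_insert _ _) (Set.mem_insert _ _)⟩
  choose s hs using hval
  refine ⟨s, fun p hp => ?_⟩
  obtain ⟨t, ht⟩ := hmax.1
    (insert p ((fun y => (Finsupp.single y (1 : R), s y)) '' (p.1.support : Set X)))
    (Set.insert_subset (hSS' hp) (by rintro _ ⟨y, -, rfl⟩; exact hs y))
    ((p.1.support.finite_toSet.image _).insert p)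
  rw [← ht p (Set.mem_insert _ _), Finsupp.linearCombination_apply,
    Finsupp.linearCombination_apply]
  refine Finsupp.sum_congr fun y hy => ?_
  have := ht _ (Set.mem_insert_of_mem _ ⟨y, hy, rfl⟩)
  simp only [Finsupp.linearCombination_single, one_smul] at this
  rw [this]

/-- An extension of `g : A → M` along `i : A → B` is a solution in `M` of the system formed by
all linear relations between the elements of `B` and the prescribed values on `i(A)`; purity of
`i` makes this system finitely solvable. -/
theorem isPureInjective_of_ppDescendingChain
    (hM : ∀ X : Type (max u v), PPDescendingChain R X M) : IsPureInjective R M := by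
  intro A B _ _ _ _ i hi g
  let S : Set ((B →₀ R) × M) :=
    {p | Finsupp.linearCombination R (id : B → B) p.1 = 0 ∧ p.2 = 0} ∪
      Set.range fun a : A => (Finsupp.single (i a) 1, g a)
  have hS : FinitelySolvable S := by
    intro T hTS hT
    let Ei : Set (B →₀ R) := Prod.fst '' (T ∩ Set.range fun a : A => (Finsupp.single (i a) 1, g a))
    let Er : Set (B →₀ R) :=
      Prod.fst '' (T ∩ {p | Finsupp.linearCombination R (id : B → B) p.1 = 0 ∧ p.2 = 0})
    -- The identity of `B` solves the relations; subtracting a lift of its class modulo `i(A)`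
    -- which vanishes at the finitely many prescribed elements gives a solution inside `i(A)`.
    obtain ⟨s, hs, hsπ⟩ := hi.2.exists_lift_solution (E := Ei ∪ Er)
      (((hT.inter_of_left _).image _).union ((hT.inter_of_left _).image _))
      (LinearMap.range i).mkQ (by
        rintro e (⟨p, ⟨-, a, rfl⟩, rfl⟩ | ⟨p, ⟨-, hp, -⟩, rfl⟩)
        · rw [Finsupp.linearCombination_single, one_smul, Submodule.mkQ_apply,
            Submodule.Quotient.mk_eq_zero]
          exact ⟨a, rfl⟩
        · rw [← Function.comp_id ((LinearMap.range i).mkQ : B → _),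
            ← Finsupp.apply_linearCombination, hp, map_zero])
    have hmem : ∀ y : B, ∃ a : A, i a = y - s y := by
      intro y
      have := hsπ y
      rw [Submodule.mkQ_apply, Submodule.mkQ_apply, eq_comm, Submodule.Quotient.eq] at this
      exact this
    choose r hr using hmem
    have hir : (i ∘ r : B → B) = id - s := funext hr
    refine ⟨g ∘ r, fun p hp => ?_⟩
    rw [← Finsupp.apply_linearCombination]
    rcases hTS hp with ⟨hp₁, hp₂⟩ | ⟨a, rfl⟩
    · have : Finsupp.linearCombination R r p.1 = 0 := by
        apply hi.1
        rw [Finsupp.apply_linearCombination, hir, linearCombination_sub_left, hp₁,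
          hs _ (Or.inr ⟨p, ⟨hp, hp₁, hp₂⟩, rfl⟩), sub_zero, map_zero]
      rw [this, map_zero, hp₂]
    · have h0 := hs _ (Or.inl ⟨_, ⟨hp, a, rfl⟩, rfl⟩)
      simp only [Finsupp.linearCombination_single, one_smul] at h0 ⊢
      congr 1
      apply hi.1
      rw [hr, h0, sub_zero]
  obtain ⟨s, hs⟩ := hS.exists_solution (hM B)
  have hrel : ∀ e : B →₀ R, Finsupp.linearCombination R (id : B → B) e = 0 →
      Finsupp.linearCombination R s e = 0 := fun e he => hs (e, 0) (Or.inl ⟨he, rfl⟩)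
  refine ⟨{ toFun := s, map_add' := fun y z => ?_, map_smul' := fun r y => ?_ }, ?_⟩
  · have := hrel (Finsupp.single (y + z) 1 - Finsupp.single y 1 - Finsupp.single z 1) (by simp)
    simp only [map_sub, Finsupp.linearCombination_single, one_smul] at this
    rwa [sub_sub, sub_eq_zero] at this
  · have := hrel (Finsupp.single (r • y) 1 - Finsupp.single y r) (by simp)
    simp only [map_sub, Finsupp.linearCombination_single, one_smul] at this
    rwa [sub_eq_zero] at this
  · ext a
    have := hs _ (Or.inr ⟨a, rfl⟩)
    simpa using this

theorem PPDescendingChain.directSum (hM : PPDescendingChain R X M) (K : Type w₁) :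
    PPDescendingChain R X (⨁ _ : K, M) := by
  intro x E hE hfin
  obtain ⟨n, hn⟩ := hM x E hE hfin
  exact ⟨n, fun k a ha => mem_ppSubgroup_directSum fun j =>
    hn k (map_mem_ppSubgroup (DirectSum.component R K (fun _ => M) j) ha)⟩

end AlgebraicallyCompact

/-! ### Cardinalities and the conclusion -/

theorem lift_mk_pi_lt_of_finite {J : Type w₂} (hJ : Infinite J) {ι : Type w₁} (hι : Finite ι)
    (U : ι → Type v₁)
    (hcard : ∀ i, Cardinal.lift.{w₂} (Cardinal.mk (U i)) < Cardinal.lift.{v₁} (Cardinal.mk J)) :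
    Cardinal.lift.{w₂} (Cardinal.mk (∀ i, U i)) < Cardinal.lift.{max v₁ w₁} (Cardinal.mk J) := by
  have := Fintype.ofFinite ι
  have hJ' : Cardinal.aleph0 ≤ Cardinal.lift.{v₁} (Cardinal.mk J) :=
    Cardinal.aleph0_le_lift.2 (Cardinal.aleph0_le_mk J)
  have hprod : ∏ i, Cardinal.lift.{w₂} (Cardinal.mk (U i)) <
      Cardinal.lift.{v₁} (Cardinal.mk J) :=
    Finset.prod_induction _ (· < Cardinal.lift.{v₁} (Cardinal.mk J))
      (fun _ _ ha hb => Cardinal.mul_lt_of_lt hJ' ha hb)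
      (Cardinal.one_lt_aleph0.trans_le hJ') fun i _ => hcard i
  have hlift := Cardinal.lift_lt.{_, w₁}.2 hprod
  rw [← Cardinal.prod_eq_of_fintype] at hlift
  rw [Cardinal.mk_pi, Cardinal.lift_prod]
  simpa using hlift

/-- A chain of pp-definable subgroups of `V` is stationary from the step `n` given by Chase's
lemma. For `m` in the `n`-th subgroup, purity lifts the copies of `m` in the summands to families
in the `n`-th subgroup of the product. There are more summands than restrictions of families to
the finitely many exceptional indices, so two of the lifts differ by a family supported on the
small set; hence `m` lies in the intersection of the chain. -/
theorem ppDescendingChain_of_isPureEpi {R : Type u} [Ring R] {I : Type w₁} {J : Type w₂}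
    (U : I → Type v₁) [∀ i, AddCommGroup (U i)] [∀ i, Module R (U i)]
    (V' : J → Type v₂) [∀ j, AddCommGroup (V' j)] [∀ j, Module R (V' j)]
    (V : Type v) [AddCommGroup V] [Module R V] (hV : ∀ j, Nonempty (V' j ≃ₗ[R] V))
    (hJ : Infinite J)
    (hcard : ∀ i, Cardinal.lift.{w₂} (Cardinal.mk (U i)) < Cardinal.lift.{v₁} (Cardinal.mk J))
    (hI : ¬ IsMeasurableIndex I)
    (f : (∀ i, U i) →ₗ[R] (⨁ j, V' j)) (hf : IsPureEpi R f) (X : Type w) :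
    PPDescendingChain R X V := by
  classical
  intro x E hE hfin
  obtain ⟨F, hF, n, J', hsmall⟩ := exists_finite_isChaseSmall_compl (f := f.toAddMonoidHom)
    (A := fun n i => ppSubgroup (E n) x (U i)) (C := fun n j => ppSubgroup (E n) x (V' j)) hI
    (fun i _ _ h => ppSubgroup_anti (hE h)) (fun j _ _ h => ppSubgroup_anti (hE h))
    (fun n a ha j => map_mem_ppSubgroup (DirectSum.component R J V' j ∘ₗ f)
      (mem_ppSubgroup_pi ha))
  refine ⟨n, fun k m hm => ?_⟩
  let φ : ∀ j, V' j ≃ₗ[R] V := fun j => (hV j).some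
  let y : ∀ j : J, ⨁ j, V' j := fun j => DirectSum.lof R J V' j ((φ j).symm m)
  have hy : ∀ j, ∃ a : ∀ i, U i, a ∈ ppSubgroup (E n) x (∀ i, U i) ∧ f a = y j := by
    intro j
    obtain ⟨t, ht, htx⟩ := map_mem_ppSubgroup
      (DirectSum.lof R J V' j ∘ₗ (φ j).symm.toLinearMap) hm
    obtain ⟨s, hs, hst⟩ := hf.exists_lift_solution (hfin n) t ht
    exact ⟨s x, ⟨s, hs, rfl⟩, (hst x).trans htx⟩
  choose a ha hfa using hy
  obtain ⟨j, hjJ', l, -, hjl, hEq⟩ : ∃ j ∉ J', ∃ l ∉ J', j ≠ l ∧ ∀ i ∈ F, a j i = a l i := by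
    by_contra! hno
    have hinj : Function.Injective
        (fun (j : ((J' : Set J)ᶜ : Set J)) (i : F) => a j i) := by
      intro j l h
      by_contra hjl
      obtain ⟨i, hi, hne⟩ := hno j j.2 l l.2 (fun h => hjl (Subtype.ext h))
      exact hne (congrFun h ⟨i, hi⟩)
    have hle := Cardinal.lift_mk_le_lift_mk_of_injective hinj
    have hlt := lift_mk_pi_lt_of_finite hJ hF.to_subtype (fun i : F => U i) fun i => hcard i
    have hcompl : Cardinal.mk ((J' : Set J)ᶜ : Set J) = Cardinal.mk J :=
      Cardinal.mk_compl_finset_of_infinite J'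
    rw [hcompl] at hle
    exact absurd hlt (not_lt.2 hle)
  have hmem := hsmall (a j - a l)
    (fun i => map_mem_ppSubgroup (LinearMap.proj (R := R) (φ := U) i) (sub_mem (ha j) (ha l)))
    (fun i hi => by
      rw [Pi.sub_apply, hEq i (Set.notMem_compl_iff.1 hi), sub_self]) j hjJ' k
  have hval : f.toAddMonoidHom (a j - a l) j = (φ j).symm m := by
    rw [map_sub, LinearMap.toAddMonoidHom_coe, hfa, hfa, DirectSum.sub_apply]
    simp only [y, DirectSum.lof_eq_of]
    rw [DirectSum.of_eq_same, DirectSum.of_eq_of_ne _ _ _ hjl, sub_zero]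
  rw [hval] at hmem
  simpa using map_mem_ppSubgroup (φ j).toLinearMap hmem

theorem corollary2p4 {R : Type u} [Ring R] {I : Type w₁} {J : Type w₂}
    (U : I → Type v₁) [∀ i, AddCommGroup (U i)] [∀ i, Module R (U i)]
    (V' : J → Type v₂) [∀ j, AddCommGroup (V' j)] [∀ j, Module R (V' j)]
    (V : Type v) [AddCommGroup V] [Module R V] (hV : ∀ j, Nonempty (V' j ≃ₗ[R] V))
    (hJ : Infinite J)
    (hcard : ∀ i, Cardinal.lift.{w₂} (Cardinal.mk (U i)) < Cardinal.lift.{v₁} (Cardinal.mk J))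
    (hI : ¬ IsMeasurableIndex I)
    (f : (∀ i, U i) →ₗ[R] (⨁ j, V' j)) (hf : IsPureEpi R f) :
    IsSigmaPureInjective.{u, v, w} R V := fun K =>
  isPureInjective_of_ppDescendingChain fun X =>
    (ppDescendingChain_of_isPureEpi U V' V hV hJ hcard hI f hf X).directSum K
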